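/- Let $n\ge 0$ and let $S_n$ be the group of permutations of $[n]=\{1,\dots,n\}$, with products composed as functions, $(uv)(i)=u(v(i))$. It has simple generators $s_i=(i\;i{+}1)$, and $\ell(u)$ denotes the minimal length of a word in the $s_i$ with product $u$. Right weak order $\le_R$ has cover relations $v\lessdot_R vs_i$ with $\ell(vs_i)=\ell(v)+1$. Bruhat order $\preceq$ has cover relations $v\prec\!\!\!\cdot\; vt$ with $t$ a transposition and $\ell(vt)=\ell(v)+1$. The set of left inversions of $u$ is $T_L(u)=\{t \text{ a transposition} : \ell(tu)<\ell(u)\}$. Fix $w\in S_n$ and write $[e,w]=\{u: u\preceq w\}$. For $u\in S_n$ let $\boldsymbol u=(u^{-1}(1),\dots,u^{-1}(n))\in\mathbb R^n$, and let $Q_w$ be the convex hull of $\{\boldsymbol u : u\preceq w\}$. For $y\in S_n$ let $C(y)=\{c\in\mathbb R^n : c_{y(1)}\le c_{y(2)}\le\dots\le c_{y(n)}\}$. Let $\Theta_w$ be the relation on $S_n$ for which $y$ and $z$ are related if and only if $C(y)$ and $C(z)$ are contained in the same full-dimensional cone of the (outer) normal fan of $Q_w$. For $u\preceq w$ let $\tilde\Gamma_w(u)$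 be the directed graph on $[n]$ with an edge $u(i)\to u(j)$ whenever $i<j$, $u(i\,j)\preceq w$ and $|\ell(u(i\,j))-\ell(u)|=1$. Let $\Gamma_w(u)$ be its transitive reduction. **Proposition.** $\Theta_w$ is an equivalence relation on $S_n$. Let $x\in S_n$ and let $[x]_w$ be its equivalence class. Then: 1. $[x]_w$ contains exactly one element $u$ of $[e,w]$, and $u$ is the minimum of $[x]_w$ under $\le_R$. 2. $[x]_w$ has a maximum $\mathrm{Top}_w(x)$ under $\le_R$. 3. $[x]_w$ is the interval $\{y\in S_n : u\le_R y\le_R \mathrm{Top}_w(x)\}$. 4. $\mathrm{Top}_w(x)$ is the unique permutation whose set of left inversions is $\{(a\,b) : a<b \text{ and there is no directed path from } a \text{ to } b \text{ in } \Gamma_w(u)\}$. -/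

import Mathlib

/-! Permutations of `[n]` are elements of `Equiv.Perm (Fin n)`; products are compositions of
functions, `(u * v) i = u (v i)`. -/

namespace BruhatPolytope

variable {n : ℕ}

/-- The simple generators `s_i = (i i+1)` of the symmetric group. -/
def IsSimple (s : Equiv.Perm (Fin n)) : Prop :=
  ∃ i j : Fin n, i.val + 1 = j.val ∧ s = Equiv.swap i j

/-- The transpositions `(i j)`, `i ≠ j`; these are the reflections of the symmetric group. -/
def IsTransposition (t : Equiv.Perm (Fin n)) : Prop :=
  ∃ i j : Fin n, i ≠ j ∧ t = Equiv.swap i j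

/-- Coxeter length: the least length of a word in the simple generators with product `w`. -/
noncomputable def length (w : Equiv.Perm (Fin n)) : ℕ :=
  sInf {k | ∃ l : List (Equiv.Perm (Fin n)), (∀ s ∈ l, IsSimple s) ∧ l.prod = w ∧ l.length = k}

/-- Right weak order: the reflexive transitive closure of `v ⋖ v s`, with `s` a simple generator
and `ℓ(v s) = ℓ(v) + 1`. -/
def WeakLE (v w : Equiv.Perm (Fin n)) : Prop :=
  Relation.ReflTransGen
    (fun a b => ∃ s, IsSimple s ∧ b = a * s ∧ length b = length a + 1) v w

/-- (Strong) Bruhat order: the reflexive transitive closure of `v ⋖ v t`, with `t` a transposition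
and `ℓ(v t) = ℓ(v) + 1`. -/
def BruhatLE (v w : Equiv.Perm (Fin n)) : Prop :=
  Relation.ReflTransGen
    (fun a b => ∃ t, IsTransposition t ∧ b = a * t ∧ length b = length a + 1) v w

/-- The left inversions `T_L(w)`: the transpositions `t` with `ℓ(t w) < ℓ(w)`. -/
def leftInversions (w : Equiv.Perm (Fin n)) : Set (Equiv.Perm (Fin n)) :=
  {t | IsTransposition t ∧ length (t * w) < length w}

/-- The vector `(u⁻¹(1), …, u⁻¹(n))`, with values in `{1, …, n}`. -/
def vec (u : Equiv.Perm (Fin n)) : Fin n → ℝ :=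
  fun i => ((u⁻¹ i : Fin n) : ℕ) + 1

/-- The Bruhat interval polytope `Q_w`. -/
def polytope (w : Equiv.Perm (Fin n)) : Set (Fin n → ℝ) :=
  convexHull ℝ {p | ∃ u, BruhatLE u w ∧ p = vec u}

/-- The face of `Q` on which the linear functional `q ↦ c ⬝ᵥ q` is maximal. -/
def face (Q : Set (Fin n → ℝ)) (c : Fin n → ℝ) : Set (Fin n → ℝ) :=
  {p | p ∈ Q ∧ ∀ q ∈ Q, c ⬝ᵥ q ≤ c ⬝ᵥ p}

/-- The (outer) normal cone of a face `F` of `Q`: the functionals maximized over `Q` at every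
point of `F`. -/
def normalCone (Q F : Set (Fin n → ℝ)) : Set (Fin n → ℝ) :=
  {c | ∀ p ∈ F, ∀ q ∈ Q, c ⬝ᵥ q ≤ c ⬝ᵥ p}

/-- The (outer) normal fan of a polytope `Q`: the normal cones of its nonempty faces (every
nonempty face of a polytope is the set of maximizers of a linear functional). -/
def normalFan (Q : Set (Fin n → ℝ)) : Set (Set (Fin n → ℝ)) :=
  {σ | ∃ c, σ = normalCone Q (face Q c)}

/-- The closed cone `C(y)` of the braid arrangement: the points whose coordinates are in the
relative order given by `y`, that is `c (y 1) ≤ ⋯ ≤ c (y n)`. It contains `vec y`. -/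
def braidCone (y : Equiv.Perm (Fin n)) : Set (Fin n → ℝ) :=
  {c | ∀ i j : Fin n, i ≤ j → c (y i) ≤ c (y j)}

/-- The relation `Θ_w` induced on permutations by the normal fan of `Q_w`: the cones `C(y)` and
`C(z)` lie in the same full-dimensional cone of the fan. -/
def Theta (w y z : Equiv.Perm (Fin n)) : Prop :=
  ∃ σ ∈ normalFan (polytope w),
    (interior σ).Nonempty ∧ braidCone y ⊆ σ ∧ braidCone z ⊆ σ

/-- The class `[x]_w`. -/
def thetaClass (w x : Equiv.Perm (Fin n)) : Set (Equiv.Perm (Fin n)) :=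
  {y | Theta w x y}

/-- Edges of the directed graph `Γ̃_w(u)` on `[n]`: the pairs `(u(i), u(j))` with `i < j`,
`u (i j) ⪯ w` and `|ℓ(u (i j)) - ℓ(u)| = 1`. -/
def TildeEdge (w u : Equiv.Perm (Fin n)) (a b : Fin n) : Prop :=
  ∃ i j : Fin n, i < j ∧ a = u i ∧ b = u j ∧ BruhatLE (u * Equiv.swap i j) w ∧
    |(length (u * Equiv.swap i j) : ℤ) - (length u : ℤ)| = 1

/-- Edges of `Γ_w(u)`, the transitive reduction of the finite acyclic directed graph `Γ̃_w(u)`: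
the edges `(a, b)` of `Γ̃_w(u)` such that no directed path from `a` to `b` in `Γ̃_w(u)` passes
through an intermediate vertex. -/
def Edge (w u : Equiv.Perm (Fin n)) (a b : Fin n) : Prop :=
  TildeEdge w u a b ∧
    ¬ ∃ c, Relation.TransGen (TildeEdge w u) a c ∧ Relation.TransGen (TildeEdge w u) c b

/-- There is a directed path (with at least one edge) from `a` to `b` in `Γ_w(u)`. -/
def HasPath (w u : Equiv.Perm (Fin n)) (a b : Fin n) : Prop :=
  Relation.TransGen (Edge w u) a b

end BruhatPolytope

/-! Everything is controlled by one vertex of `Q_w` per permutation. For each `y`, the set `y⁻¹[e,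
w]` has a Bruhat minimum `y⁻¹u` with `u ⪯ w` (`exists_isRepr`, by induction on `w` from the lifting
property). Functionals in `C(y)` weakly decrease along Bruhat order translated by `y`, strictly in
the open cone, so on the open cone only `vec u` is maximal among the vectors of `[e, w]`. Hence `y`
and `z` are related exactly when they have the same `u` (`theta_iff`), and each class meets `[e, w]`
only in its `u`.

The minimality of `y⁻¹u` can be tested on the neighbours of `u` in `[e, w]`: it holds iff `y` is a
linear extension of `Γ̃_w(u)` (`IsRepr.lt_of_tildeEdge`, `isRepr_of_tildeEdge_lt`). Every inversion
of `u` is a path of this graph, so a linear extension lies weakly above `u`; it inverts no `a < b`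
joined by a path from `a` to `b`. The path relation is transitive, and its complement is transitive
along increasing triples (`transGen_tildeEdge_between`), so the remaining pairs are the inversions
of a permutation, the top of the class. Weak order is containment of left inversions, whence the
interval. -/

namespace BruhatPolytope

variable {n : ℕ}

open Equiv Relation

/-! ### Length as the number of inversions -/

/-- The number of inversions of a permutation. -/
def invCount (x : Perm (Fin n)) : ℕ :=
  (Finset.univ.filter fun p : Fin n × Fin n => p.1 < p.2 ∧ x p.2 < x p.1).card

theorem swap_adjacent_lt {i j p q : Fin n} (hij : i.val + 1 = j.val) (hpq : p < q)
    (hne : ¬(p = i ∧ q = j)) : swap i j p < swap i j q := by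
  simp only [swap_apply_def, Fin.lt_def, Fin.ext_iff] at *
  split_ifs <;> omega

/-- Applying the swap to both positions of a pair sends the inversions of `x` bijectively onto the
inversions of the product other than `(i, j)`. -/
theorem invCount_mul_swap_of_lt (x : Perm (Fin n)) {i j : Fin n} (hij : i.val + 1 = j.val)
    (hx : x i < x j) : invCount (x * swap i j) = invCount x + 1 := by
  have hlt : i < j := by simp only [Fin.lt_def]; omega
  have hmem : (i, j) ∉ (Finset.univ.filter fun p : Fin n × Fin n => p.1 < p.2 ∧ x p.2 < x p.1).map
      ((swap i j).prodCongr (swap i j)).toEmbedding := by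
    simp only [Finset.mem_map, Finset.mem_filter, Finset.mem_univ, true_and, not_exists, not_and]
    rintro ⟨p, q⟩ ⟨h1, -⟩ h2
    have hp : swap i j p = i := congrArg Prod.fst h2
    have hq : swap i j q = j := congrArg Prod.snd h2
    rw [swap_apply_eq_iff, swap_apply_left] at hp
    rw [swap_apply_eq_iff, swap_apply_right] at hq
    subst hp hq
    exact absurd h1 (not_lt.2 hlt.le)
  refine Eq.trans ?_ ((Finset.card_cons hmem).trans (by rw [Finset.card_map, invCount]))
  rw [invCount]
  congr 1
  ext ⟨p, q⟩
  simp only [Finset.mem_cons, Finset.mem_map_equiv, Finset.mem_filter, Finset.mem_univ, true_and,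
    Prod.mk.injEq]
  have hs : ((swap i j).prodCongr (swap i j)).symm (p, q) = (swap i j p, swap i j q) := by simp
  rw [hs, Perm.mul_apply, Perm.mul_apply]
  by_cases hpq : p = i ∧ q = j
  · obtain ⟨rfl, rfl⟩ := hpq
    simp [hlt, hx]
  · simp only [hpq, false_or]
    refine and_congr_left fun h => ⟨fun h1 => swap_adjacent_lt hij h1 hpq, fun h1 => ?_⟩
    by_cases hne : swap i j p = i ∧ swap i j q = j
    · rw [hne.1, hne.2] at h
      exact absurd h (not_lt.2 hx.le)
    · simpa using swap_adjacent_lt hij h1 hne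

theorem invCount_mul_swap_of_gt (x : Perm (Fin n)) {i j : Fin n} (hij : i.val + 1 = j.val)
    (hx : x j < x i) : invCount (x * swap i j) + 1 = invCount x := by
  rw [← invCount_mul_swap_of_lt (x * swap i j) hij (by simpa using hx), mul_assoc, swap_mul_self,
    mul_one]

theorem eq_one_of_adjacent_lt {x : Perm (Fin n)}
    (h : ∀ i j : Fin n, i.val + 1 = j.val → x i < x j) : x = 1 := by
  have hm : StrictMono x := by
    rcases n with _ | m
    · exact fun a => a.elim0
    · exact Fin.strictMono_iff_lt_succ.2 fun i => h _ _ (by simp)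
  have := Subsingleton.elim (hm.orderIsoOfSurjective x x.surjective) (OrderIso.refl _)
  ext i
  exact congrArg (fun f : Fin n ≃o Fin n => (f i).val) this

theorem exists_adjacent_gt {x : Perm (Fin n)} (h : x ≠ 1) :
    ∃ i j : Fin n, i.val + 1 = j.val ∧ x j < x i := by
  by_contra! hc
  refine h (eq_one_of_adjacent_lt fun i j hij => lt_of_le_of_ne (hc i j hij) fun he => ?_)
  have := congrArg Fin.val (x.injective he)
  omega

theorem invCount_one : invCount (1 : Perm (Fin n)) = 0 := by
  rw [invCount, Finset.card_eq_zero, Finset.filter_eq_empty_iff]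
  rintro p - ⟨h1, h2⟩
  exact lt_asymm h1 h2

theorem exists_word (x : Perm (Fin n)) :
    ∃ l : List (Perm (Fin n)), (∀ s ∈ l, IsSimple s) ∧ l.prod = x ∧ l.length = invCount x := by
  induction hk : invCount x generalizing x with
  | zero =>
    refine ⟨[], by simp, ?_, by simp⟩
    by_contra hne
    obtain ⟨i, j, hij, hx⟩ := exists_adjacent_gt (Ne.symm hne)
    have := invCount_mul_swap_of_gt x hij hx
    omega
  | succ k ih =>
    obtain ⟨i, j, hij, hx⟩ := exists_adjacent_gt (x := x) (by
      rintro rfl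
      simp [invCount_one] at hk)
    obtain ⟨l, hl, hp, hlen⟩ := ih (x * swap i j)
      (by have := invCount_mul_swap_of_gt x hij hx; omega)
    refine ⟨l ++ [swap i j], ?_, ?_, by simp [hlen]⟩
    · simp only [List.mem_append, List.mem_singleton]
      rintro s (hs | rfl)
      exacts [hl s hs, ⟨i, j, hij, rfl⟩]
    · simp [hp, mul_assoc]

theorem invCount_mul_simple_le (x : Perm (Fin n)) {s : Perm (Fin n)} (hs : IsSimple s) :
    invCount (x * s) ≤ invCount x + 1 := by
  obtain ⟨i, j, hij, rfl⟩ := hs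
  rcases lt_trichotomy (x i) (x j) with h | h | h
  · exact (invCount_mul_swap_of_lt x hij h).le
  · have := congrArg Fin.val (x.injective h)
    omega
  · have := invCount_mul_swap_of_gt x hij h
    omega

theorem invCount_prod_le (l : List (Perm (Fin n))) (hl : ∀ s ∈ l, IsSimple s) :
    invCount l.prod ≤ l.length := by
  induction l using List.reverseRecOn with
  | nil => simp [invCount_one]
  | append_singleton l s ih =>
    have h1 := ih fun t ht => hl t (by simp [ht])
    have h2 := invCount_mul_simple_le l.prod (hl s (by simp))
    simp only [List.prod_append, List.prod_singleton, List.length_append, List.length_singleton]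
    omega

theorem length_eq_invCount (x : Perm (Fin n)) : length x = invCount x := by
  refine le_antisymm (Nat.sInf_le (exists_word x)) (le_csInf ⟨_, exists_word x⟩ ?_)
  rintro k ⟨l, hl, rfl, rfl⟩
  exact invCount_prod_le l hl

theorem length_mul_swap_adjacent_of_lt (x : Perm (Fin n)) {i j : Fin n} (hij : i.val + 1 = j.val)
    (hx : x i < x j) : length (x * swap i j) = length x + 1 := by
  simpa only [length_eq_invCount] using invCount_mul_swap_of_lt x hij hx

theorem length_mul_swap_adjacent_of_gt (x : Perm (Fin n)) {i j : Fin n} (hij : i.val + 1 = j.val)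
    (hx : x j < x i) : length (x * swap i j) + 1 = length x := by
  simpa only [length_eq_invCount] using invCount_mul_swap_of_gt x hij hx

/-! ### Length under multiplication by a transposition -/

/-- Conjugating `(i j)` by the simple generator `(i k)`, `k = i + 1`. -/
theorem mul_swap_eq_conj (x : Perm (Fin n)) {i j k : Fin n} (hik : i ≠ k) (hij : i ≠ j)
    (hkj : k ≠ j) : x * swap i j = x * swap i k * swap k j * swap i k := by
  rw [mul_assoc, mul_assoc]
  congr 1
  ext a
  congr 1
  simp only [Perm.mul_apply, swap_apply_def]
  split_ifs <;> grind

/-- After conjugation the middle factor raises the length by induction. The two simple factors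
change it by one each, and cannot both lower it: that would need `x k < x i` and `x j < x k`. -/
theorem length_lt_mul_swap (x : Perm (Fin n)) {i j : Fin n} (hij : i < j) (hx : x i < x j) :
    length x < length (x * swap i j) := by
  induction hd : j.val - i.val generalizing i x with
  | zero => simp only [Fin.lt_def] at hij; omega
  | succ d ih =>
    simp only [Fin.lt_def] at hij
    by_cases h1 : i.val + 1 = j.val
    · rw [length_mul_swap_adjacent_of_lt x h1 hx]
      omega
    · obtain ⟨k, hk⟩ : ∃ k : Fin n, i.val + 1 = k.val := ⟨⟨i.val + 1, by omega⟩, rfl⟩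
      have hik : i ≠ k := fun h => by rw [h] at hk; omega
      have hkj : k ≠ j := fun h => h1 (h ▸ hk)
      have hij' : i ≠ j := fun h => by rw [h] at hij; omega
      have h2 := ih (x * swap i k) (i := k) (by simp only [Fin.lt_def]; omega)
        (by simpa [swap_apply_of_ne_of_ne hij'.symm hkj.symm] using hx) (by omega)
      rw [mul_swap_eq_conj x hik hij' hkj]
      have hi : (x * swap i k * swap k j) i = x k := by
        simp [swap_apply_of_ne_of_ne hik hij']
      have hk' : (x * swap i k * swap k j) k = x j := by
        simp [swap_apply_of_ne_of_ne hij'.symm hkj.symm]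
      rcases lt_or_gt_of_ne (x.injective.ne hik) with h3 | h3
      · have h4 := length_mul_swap_adjacent_of_lt x hk h3
        rcases lt_or_gt_of_ne (x.injective.ne hkj) with h5 | h5
        · have := length_mul_swap_adjacent_of_lt (x * swap i k * swap k j) hk (by rwa [hi, hk'])
          omega
        · have := length_mul_swap_adjacent_of_gt (x * swap i k * swap k j) hk (by rwa [hi, hk'])
          omega
      · have h4 := length_mul_swap_adjacent_of_gt x hk h3
        have := length_mul_swap_adjacent_of_lt (x * swap i k * swap k j) hk
          (by rw [hi, hk']; exact h3.trans hx)
        omega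

theorem length_lt_mul_swap_iff (x : Perm (Fin n)) {i j : Fin n} (hij : i < j) :
    length x < length (x * swap i j) ↔ x i < x j := by
  refine ⟨fun h => ?_, length_lt_mul_swap x hij⟩
  by_contra hc
  have h1 : x j < x i := lt_of_le_of_ne (not_lt.1 hc) (x.injective.ne hij.ne')
  have h2 := length_lt_mul_swap (x * swap i j) hij (by simpa using h1)
  rw [mul_assoc, swap_mul_self, mul_one] at h2
  omega

theorem length_mul_swap_lt_iff (x : Perm (Fin n)) {i j : Fin n} (hij : i < j) :
    length (x * swap i j) < length x ↔ x j < x i := by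
  have := length_lt_mul_swap_iff (x * swap i j) hij
  rw [mul_assoc, swap_mul_self, mul_one] at this
  simpa using this

/-- Since `x k` is not between `x i` and `x j`, the two simple factors of the conjugation cancel in
length. -/
theorem length_mul_swap_of_no_between (x : Perm (Fin n)) {i j : Fin n} (hij : i < j)
    (hx : x i < x j) (hb : ∀ k, i < k → k < j → ¬(x i < x k ∧ x k < x j)) :
    length (x * swap i j) = length x + 1 := by
  induction hd : j.val - i.val generalizing i x with
  | zero => simp only [Fin.lt_def] at hij; omega
  | succ d ih =>
    simp only [Fin.lt_def] at hij
    by_cases h1 : i.val + 1 = j.val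
    · exact length_mul_swap_adjacent_of_lt x h1 hx
    · obtain ⟨k, hk⟩ : ∃ k : Fin n, i.val + 1 = k.val := ⟨⟨i.val + 1, by omega⟩, rfl⟩
      have hik : i ≠ k := fun h => by rw [h] at hk; omega
      have hkj : k ≠ j := fun h => h1 (h ▸ hk)
      have hij' : i ≠ j := fun h => by rw [h] at hij; omega
      have h2 := ih (x * swap i k) (i := k) (by simp only [Fin.lt_def]; omega)
        (by simpa [swap_apply_of_ne_of_ne hij'.symm hkj.symm] using hx)
        (fun m hm1 hm2 => by
          have hmi : m ≠ i := fun h => by simp only [h, Fin.lt_def] at hm1; omega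
          have := hb m (by simp only [Fin.lt_def] at *; omega) hm2
          simpa [swap_apply_of_ne_of_ne hij'.symm hkj.symm, swap_apply_of_ne_of_ne hmi hm1.ne']
            using this) (by omega)
      rw [mul_swap_eq_conj x hik hij' hkj]
      have hi : (x * swap i k * swap k j) i = x k := by
        simp [swap_apply_of_ne_of_ne hik hij']
      have hk' : (x * swap i k * swap k j) k = x j := by
        simp [swap_apply_of_ne_of_ne hij'.symm hkj.symm]
      have hbk := hb k (by simp only [Fin.lt_def]; omega) (by simp only [Fin.lt_def]; omega)
      rcases lt_or_gt_of_ne (x.injective.ne hik) with h3 | h3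
      · have h4 := length_mul_swap_adjacent_of_lt x hk h3
        have h5 : x j < x k := lt_of_le_of_ne (not_lt.1 fun h => hbk ⟨h3, h⟩)
          (x.injective.ne hkj.symm)
        have := length_mul_swap_adjacent_of_gt (x * swap i k * swap k j) hk (by rwa [hi, hk'])
        omega
      · have h4 := length_mul_swap_adjacent_of_gt x hk h3
        have := length_mul_swap_adjacent_of_lt (x * swap i k * swap k j) hk
          (by rw [hi, hk']; exact h3.trans hx)
        omega

theorem length_add_two_lt_of_between (x : Perm (Fin n)) {i j k : Fin n} (hik : i < k) (hkj : k < j)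
    (h1 : x i < x k) (h2 : x k < x j) : length x + 2 < length (x * swap i j) := by
  have hij := hik.trans hkj
  rw [mul_swap_eq_conj x hik.ne hij.ne hkj.ne]
  have l1 := length_lt_mul_swap x hik h1
  have l2 := length_lt_mul_swap (x * swap i k) hkj
    (by simpa [swap_apply_of_ne_of_ne hij.ne' hkj.ne'] using h1.trans h2)
  have l3 := length_lt_mul_swap (x * swap i k * swap k j) hik
    (by simpa [swap_apply_of_ne_of_ne hij.ne' hkj.ne', swap_apply_of_ne_of_ne hik.ne hij.ne]
      using h2)
  omega

/-- No position between `i` and `j` carries a value between `x i` and `x j`. -/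
def NoBetween (x : Perm (Fin n)) (i j : Fin n) : Prop :=
  ∀ k, i < k → k < j → ¬(x i < x k ∧ x k < x j) ∧ ¬(x j < x k ∧ x k < x i)

theorem NoBetween.mul_swap {x : Perm (Fin n)} {i j : Fin n} (h : NoBetween x i j) :
    NoBetween (x * swap i j) i j := by
  intro k hik hkj
  simpa [swap_apply_of_ne_of_ne hik.ne' hkj.ne, and_comm] using h k hik hkj

theorem abs_length_sub_eq_one_iff (x : Perm (Fin n)) {i j : Fin n} (hij : i < j) :
    |(length (x * swap i j) : ℤ) - length x| = 1 ↔ NoBetween x i j := by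
  have hx' : x = x * swap i j * swap i j := by rw [mul_assoc, swap_mul_self, mul_one]
  constructor
  · intro h k hik hkj
    constructor
    · rintro ⟨h1, h2⟩
      have := length_add_two_lt_of_between x hik hkj h1 h2
      rcases abs_eq (by norm_num : (0 : ℤ) ≤ 1) |>.1 h with h | h <;> omega
    · rintro ⟨h1, h2⟩
      have := length_add_two_lt_of_between (x * swap i j) hik hkj
        (by simpa [swap_apply_of_ne_of_ne hik.ne' hkj.ne] using h1)
        (by simpa [swap_apply_of_ne_of_ne hik.ne' hkj.ne] using h2)
      rw [← hx'] at this
      rcases abs_eq (by norm_num : (0 : ℤ) ≤ 1) |>.1 h with h | h <;> omega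
  · intro h
    rw [abs_eq (by norm_num)]
    rcases lt_or_gt_of_ne (x.injective.ne hij.ne) with h1 | h1
    · have := length_mul_swap_of_no_between x hij h1 fun k a b => (h k a b).1
      omega
    · have := length_mul_swap_of_no_between (x * swap i j) hij (by simpa using h1)
        fun k a b => (h.mul_swap k a b).1
      rw [← hx'] at this
      omega

/-! ### Bruhat order -/

theorem IsTransposition.exists_lt {t : Perm (Fin n)} (h : IsTransposition t) :
    ∃ k l : Fin n, k < l ∧ t = swap k l := by
  obtain ⟨k, l, hne, rfl⟩ := h
  rcases lt_or_gt_of_ne hne with h | h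
  exacts [⟨k, l, h, rfl⟩, ⟨l, k, h, swap_comm k l⟩]

theorem BruhatLE.refl (v : Perm (Fin n)) : BruhatLE v v := Relation.ReflTransGen.refl

theorem BruhatLE.trans {u v w : Perm (Fin n)} (h1 : BruhatLE u v) (h2 : BruhatLE v w) :
    BruhatLE u w := Relation.ReflTransGen.trans h1 h2

theorem bruhatLE_of_cover {u t : Perm (Fin n)} (ht : IsTransposition t)
    (h : length (u * t) = length u + 1) : BruhatLE u (u * t) :=
  Relation.ReflTransGen.single ⟨t, ht, rfl, h⟩

theorem BruhatLE.eq_or_length_lt {u v : Perm (Fin n)} (h : BruhatLE u v) :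
    u = v ∨ length u < length v := by
  induction h with
  | refl => exact Or.inl rfl
  | tail _ hc ih =>
    obtain ⟨t, -, -, h⟩ := hc
    rcases ih with rfl | ih <;> right <;> omega

theorem BruhatLE.antisymm {u v : Perm (Fin n)} (h1 : BruhatLE u v) (h2 : BruhatLE v u) : u = v := by
  rcases h1.eq_or_length_lt with h | h
  · exact h
  · rcases h2.eq_or_length_lt with h' | h'
    · exact h'.symm
    · omega

theorem length_one : length (1 : Perm (Fin n)) = 0 := by
  rw [length_eq_invCount, invCount_one]

theorem bruhatLE_one_iff {u : Perm (Fin n)} : BruhatLE u 1 ↔ u = 1 := by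
  refine ⟨fun h => ?_, fun h => h ▸ BruhatLE.refl 1⟩
  rcases h.eq_or_length_lt with h | h
  · exact h
  · rw [length_one] at h
    omega

/-! ### The lifting property -/

/-- The smaller of `x` and `x s`, for `s = (i j)` a simple generator. -/
def lower (i j : Fin n) (x : Perm (Fin n)) : Perm (Fin n) :=
  if x j < x i then x * swap i j else x

/-- The larger of `x` and `x s`, for `s = (i j)` a simple generator. -/
def upper (i j : Fin n) (x : Perm (Fin n)) : Perm (Fin n) :=
  if x j < x i then x else x * swap i j

section Lifting

variable {i j : Fin n}

theorem ne_of_adjacent (hij : i.val + 1 = j.val) : i ≠ j := fun h => by rw [h] at hij; omega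

theorem lt_of_adjacent (hij : i.val + 1 = j.val) : i < j := by
  simp only [Fin.lt_def]; omega

theorem bruhatLE_mul_swap_of_lt (hij : i.val + 1 = j.val) {x : Perm (Fin n)} (hx : x i < x j) :
    BruhatLE x (x * swap i j) :=
  bruhatLE_of_cover ⟨i, j, ne_of_adjacent hij, rfl⟩ (length_mul_swap_adjacent_of_lt x hij hx)

theorem bruhatLE_mul_swap_of_gt (hij : i.val + 1 = j.val) {x : Perm (Fin n)} (hx : x j < x i) :
    BruhatLE (x * swap i j) x := by
  have := bruhatLE_mul_swap_of_lt hij (x := x * swap i j) (by simpa using hx)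
  rwa [mul_assoc, swap_mul_self, mul_one] at this

theorem lower_bruhatLE (hij : i.val + 1 = j.val) (x : Perm (Fin n)) :
    BruhatLE (lower i j x) x := by
  rw [lower]
  split_ifs with h
  exacts [bruhatLE_mul_swap_of_gt hij h, .refl x]

theorem bruhatLE_upper (hij : i.val + 1 = j.val) (x : Perm (Fin n)) :
    BruhatLE x (upper i j x) := by
  rw [upper]
  split_ifs with h
  · exact .refl x
  · exact bruhatLE_mul_swap_of_lt hij
      (lt_of_le_of_ne (not_lt.1 h) (x.injective.ne (ne_of_adjacent hij)))

theorem lower_bruhatLE_mul_swap (hij : i.val + 1 = j.val) (x : Perm (Fin n)) :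
    BruhatLE (lower i j x) (x * swap i j) := by
  rw [lower]
  split_ifs with h
  · exact .refl _
  · exact bruhatLE_mul_swap_of_lt hij
      (lt_of_le_of_ne (not_lt.1 h) (x.injective.ne (ne_of_adjacent hij)))

theorem mul_swap_bruhatLE_upper (hij : i.val + 1 = j.val) (x : Perm (Fin n)) :
    BruhatLE (x * swap i j) (upper i j x) := by
  rw [upper]
  split_ifs with h
  exacts [bruhatLE_mul_swap_of_gt hij h, .refl _]

/-- Write `s = (i j)`, `t = (k l)`. If `t ≠ s`, conjugation by `s` keeps the two positions in order,
so `ℓ(as) < ℓ(ats)`; but `ℓ(as) = ℓ(a) + 1` and `ℓ(ats) = ℓ(at) - 1 = ℓ(a)`. -/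
theorem eq_swap_of_cover (hij : i.val + 1 = j.val) {a : Perm (Fin n)} {k l : Fin n} (hkl : k < l)
    (hc : length (a * swap k l) = length a + 1) (ha : a i < a j)
    (hb : (a * swap k l) j < (a * swap k l) i) : k = i ∧ l = j := by
  by_contra hne
  have h1 := swap_adjacent_lt hij hkl hne
  have h2 := (length_lt_mul_swap_iff a hkl).1 (by omega)
  have h3 := length_lt_mul_swap (a * swap i j) h1 (by simpa using h2)
  have h4 := length_mul_swap_adjacent_of_gt (a * swap k l) hij hb
  have h5 := length_mul_swap_adjacent_of_lt a hij ha
  have h6 : a * swap i j * swap (swap i j k) (swap i j l) = a * swap k l * swap i j := by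
    rw [swap_apply_apply]
    simp [mul_assoc]
  rw [h6] at h3
  omega

theorem mul_swap_mono_of_cover {a : Perm (Fin n)} {k l : Fin n} (hkl : k < l)
    (h : length (a * swap k l * swap i j) = length (a * swap i j) + 1) :
    BruhatLE (a * swap i j) (a * swap k l * swap i j) := by
  have h6 : a * swap k l * swap i j = a * swap i j * swap (swap i j k) (swap i j l) := by
    rw [swap_apply_apply]
    simp [mul_assoc]
  rw [h6] at h ⊢
  exact bruhatLE_of_cover ⟨_, _, (swap i j).injective.ne hkl.ne, rfl⟩ h

theorem BruhatLE.lower_mono (hij : i.val + 1 = j.val) {u v : Perm (Fin n)} (h : BruhatLE u v) :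
    BruhatLE (lower i j u) (lower i j v) := by
  induction h with
  | refl => exact .refl _
  | @tail a b _ hc ih =>
    refine ih.trans ?_
    obtain ⟨t, ht, rfl, hl⟩ := hc
    obtain ⟨k, l, hkl, rfl⟩ := ht.exists_lt
    have hab := bruhatLE_of_cover ht hl
    by_cases hb : (a * swap k l) j < (a * swap k l) i
    · by_cases ha : a j < a i
      · rw [lower, lower, if_pos ha, if_pos hb]
        apply mul_swap_mono_of_cover hkl
        have := length_mul_swap_adjacent_of_gt a hij ha
        have := length_mul_swap_adjacent_of_gt _ hij hb
        omega
      · obtain ⟨rfl, rfl⟩ := eq_swap_of_cover hij hkl hl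
          (lt_of_le_of_ne (not_lt.1 ha) (a.injective.ne (ne_of_adjacent hij))) hb
        rw [lower, lower, if_neg ha, if_pos hb, mul_assoc, swap_mul_self, mul_one]
        exact .refl a
    · rw [lower.eq_1 i j (a * swap k l), if_neg hb]
      exact (lower_bruhatLE hij a).trans hab

theorem BruhatLE.upper_mono (hij : i.val + 1 = j.val) {u v : Perm (Fin n)} (h : BruhatLE u v) :
    BruhatLE (upper i j u) (upper i j v) := by
  induction h with
  | refl => exact .refl _
  | @tail a b _ hc ih =>
    refine ih.trans ?_
    obtain ⟨t, ht, rfl, hl⟩ := hc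
    obtain ⟨k, l, hkl, rfl⟩ := ht.exists_lt
    have hab := bruhatLE_of_cover ht hl
    by_cases ha : a j < a i
    · rw [upper, if_pos ha]
      exact hab.trans (bruhatLE_upper hij _)
    · have ha' := lt_of_le_of_ne (not_lt.1 ha) (a.injective.ne (ne_of_adjacent hij))
      by_cases hb : (a * swap k l) j < (a * swap k l) i
      · obtain ⟨rfl, rfl⟩ := eq_swap_of_cover hij hkl hl ha' hb
        rw [upper, upper, if_neg ha, if_pos hb]
        exact .refl _
      · rw [upper, upper, if_neg ha, if_neg hb]
        apply mul_swap_mono_of_cover hkl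
        have := length_mul_swap_adjacent_of_lt a hij ha'
        have := length_mul_swap_adjacent_of_lt (a * swap k l) hij
          (lt_of_le_of_ne (not_lt.1 hb) (Equiv.injective _ |>.ne (ne_of_adjacent hij)))
        omega

/-- If `w s > w` then `[e, w s] = [e, w] ∪ [e, w] s`. -/
theorem bruhatLE_mul_swap_iff (hij : i.val + 1 = j.val) {w : Perm (Fin n)} (hw : w i < w j)
    (u : Perm (Fin n)) :
    BruhatLE u (w * swap i j) ↔ BruhatLE u w ∨ BruhatLE (u * swap i j) w := by
  constructor
  · intro h
    have h1 := h.lower_mono hij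
    rw [lower.eq_1 i j (w * swap i j), if_pos (by simpa using hw), mul_assoc, swap_mul_self,
      mul_one, lower] at h1
    split_ifs at h1
    exacts [Or.inr h1, Or.inl h1]
  · rintro (h | h)
    · exact h.trans (bruhatLE_mul_swap_of_lt hij hw)
    · have h1 := h.upper_mono hij
      rw [upper.eq_1 i j w, if_neg hw.not_gt] at h1
      have h2 := mul_swap_bruhatLE_upper hij (u * swap i j)
      rw [mul_assoc, swap_mul_self, mul_one] at h2
      exact h2.trans h1

end Lifting

/-! ### Bruhat minima of the translates of `[e, w]` -/

/-- Induction along a reduced word. -/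
theorem bruhat_induction {p : Perm (Fin n) → Prop} (one : p 1)
    (step : ∀ w (i j : Fin n), i.val + 1 = j.val → w i < w j → p w → p (w * swap i j))
    (w : Perm (Fin n)) : p w := by
  induction hk : length w using Nat.strong_induction_on generalizing w with
  | _ k ih =>
    by_cases hw : w = 1
    · exact hw ▸ one
    · obtain ⟨i, j, hij, hx⟩ := exists_adjacent_gt hw
      have h1 := length_mul_swap_adjacent_of_gt w hij hx
      have := step (w * swap i j) i j hij (by simpa using hx) (ih _ (by omega) _ rfl)
      rwa [mul_assoc, swap_mul_self, mul_one] at this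

/-- `u` lies in `[e, w]` and `y⁻¹ u` is the Bruhat minimum of `y⁻¹ [e, w]`. -/
def IsRepr (w y u : Perm (Fin n)) : Prop :=
  BruhatLE u w ∧ ∀ v, BruhatLE v w → BruhatLE (y⁻¹ * u) (y⁻¹ * v)

theorem IsRepr.unique {w y u v : Perm (Fin n)} (hu : IsRepr w y u) (hv : IsRepr w y v) : u = v :=
  mul_left_cancel ((hu.2 v hv.1).antisymm (hv.2 u hu.1))

/-- Passing to `ws` adjoins `y⁻¹[e, w]s` to `y⁻¹[e, w]`. As `lower` is monotone, lowering the old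
minimum gives an element below both `x` and `xs` for every old `x`. -/
theorem IsRepr.lower {w y u : Perm (Fin n)} {i j : Fin n} (hij : i.val + 1 = j.val)
    (hw : w i < w j) (h : IsRepr w y u) :
    IsRepr (w * swap i j) y (y * BruhatPolytope.lower i j (y⁻¹ * u)) := by
  constructor
  · rw [bruhatLE_mul_swap_iff hij hw, BruhatPolytope.lower]
    split_ifs
    · right
      simpa [mul_assoc] using h.1
    · left
      simpa using h.1
  · intro v hv
    rw [inv_mul_cancel_left]
    rcases (bruhatLE_mul_swap_iff hij hw v).1 hv with hv | hv
    · exact (lower_bruhatLE hij _).trans (h.2 v hv)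
    · have h1 := ((h.2 _ hv).lower_mono hij).trans (lower_bruhatLE_mul_swap hij _)
      rwa [← mul_assoc, mul_assoc, swap_mul_self, mul_one] at h1

theorem exists_isRepr (w y : Perm (Fin n)) : ∃ u, IsRepr w y u := by
  induction w using bruhat_induction with
  | one =>
    refine ⟨1, .refl 1, fun v hv => ?_⟩
    rw [bruhatLE_one_iff.1 hv]
    exact .refl _
  | step w i j hij hw ih =>
    obtain ⟨u, hu⟩ := ih
    exact ⟨_, hu.lower hij hw⟩

theorem one_bruhatLE (w : Perm (Fin n)) : BruhatLE 1 w := by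
  induction w using bruhat_induction with
  | one => exact .refl 1
  | step w i j hij hw ih => exact ih.trans (bruhatLE_mul_swap_of_lt hij hw)

theorem isRepr_self {w u : Perm (Fin n)} (h : BruhatLE u w) : IsRepr w u u :=
  ⟨h, fun v _ => by rw [inv_mul_cancel]; exact one_bruhatLE _⟩

/-! ### Weak order as containment of left inversions -/

section Weak

theorem mem_leftInversions_swap (z : Perm (Fin n)) {a b : Fin n} (hab : a < b) :
    swap a b ∈ leftInversions z ↔ z⁻¹ b < z⁻¹ a := by
  have h : IsTransposition (swap a b) := ⟨a, b, hab.ne, rfl⟩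
  rw [leftInversions, Set.mem_ofPred_eq, swap_mul_eq_mul_swap, and_iff_right h]
  rcases lt_or_gt_of_ne ((z⁻¹).injective.ne hab.ne) with h1 | h1
  · rw [length_mul_swap_lt_iff z h1]
    rw [show z (z⁻¹ a) = a by simp, show z (z⁻¹ b) = b by simp, iff_false_left hab.not_gt]
    exact h1.not_gt
  · rw [swap_comm, length_mul_swap_lt_iff z h1]
    rw [show z (z⁻¹ a) = a by simp, show z (z⁻¹ b) = b by simp, iff_true_left hab]
    exact h1

/-- Every left inversion of `u` is a left inversion of `y`. -/
def InvLE (u y : Perm (Fin n)) : Prop :=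
  ∀ a b : Fin n, a < b → u⁻¹ b < u⁻¹ a → y⁻¹ b < y⁻¹ a

theorem InvLE.mul_swap {u y : Perm (Fin n)} {i j : Fin n} (hij : i.val + 1 = j.val)
    (h : InvLE u y) (hy : y⁻¹ (u j) < y⁻¹ (u i)) : InvLE (u * swap i j) y := by
  intro a b hab hinv
  rw [mul_inv_rev, swap_inv, Perm.mul_apply, Perm.mul_apply] at hinv
  by_cases hc : swap i j (u⁻¹ b) = i ∧ swap i j (u⁻¹ a) = j
  · rw [swap_apply_eq_iff, swap_apply_left, swap_apply_eq_iff, swap_apply_right,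
      Perm.inv_eq_iff_eq, Perm.inv_eq_iff_eq] at hc
    rwa [hc.1, hc.2]
  · have := swap_adjacent_lt hij hinv hc
    simp only [swap_apply_self] at this
    exact h a b hab this

theorem WeakLE.invLE {u y : Perm (Fin n)} (h : WeakLE u y) : InvLE u y := by
  induction h with
  | refl => exact fun _ _ _ h => h
  | @tail v z _ hc ih =>
    obtain ⟨s, ⟨i, j, hij, rfl⟩, rfl, hl⟩ := hc
    intro a b hab hinv
    have h1 := ih a b hab hinv
    rw [mul_inv_rev, swap_inv, Perm.mul_apply, Perm.mul_apply]
    refine swap_adjacent_lt hij h1 ?_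
    rintro ⟨h2, h3⟩
    rw [Perm.inv_eq_iff_eq] at h2 h3
    have := (length_lt_mul_swap_iff v (lt_of_adjacent hij)).1 (by omega)
    rw [← h2, ← h3] at this
    exact lt_asymm hab this

/-- A descent of `y⁻¹u` at `i` is an ascent of `u`, since a descent of `u` would be an inversion of
`y`. So `us` covers `u`, is still below `y`, and `y⁻¹us` is shorter. -/
theorem InvLE.weakLE {u y : Perm (Fin n)} (h : InvLE u y) : WeakLE u y := by
  induction hk : length (y⁻¹ * u) using Nat.strong_induction_on generalizing u with
  | _ k ih =>
    by_cases he : y⁻¹ * u = 1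
    · rw [inv_mul_eq_one.1 he]
      exact ReflTransGen.refl
    · obtain ⟨i, j, hij, hx⟩ := exists_adjacent_gt he
      rw [Perm.mul_apply, Perm.mul_apply] at hx
      have hu : u i < u j := by
        by_contra hc
        have h1 : u j < u i := lt_of_le_of_ne (not_lt.1 hc) (u.injective.ne (ne_of_adjacent hij).symm)
        exact lt_asymm hx (h _ _ h1 (by simpa using lt_of_adjacent hij))
      have h1 := length_mul_swap_adjacent_of_gt (y⁻¹ * u) hij hx
      refine ReflTransGen.head ⟨_, ⟨i, j, hij, rfl⟩, rfl, length_mul_swap_adjacent_of_lt u hij hu⟩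
        (ih _ ?_ (h.mul_swap hij hx) rfl)
      rw [← mul_assoc]
      omega

theorem weakLE_iff_invLE {u y : Perm (Fin n)} : WeakLE u y ↔ InvLE u y :=
  ⟨WeakLE.invLE, InvLE.weakLE⟩

theorem WeakLE.bruhatLE {u y : Perm (Fin n)} (h : WeakLE u y) : BruhatLE u y := by
  refine ReflTransGen.mono (fun a b => ?_) u y h
  rintro ⟨s, ⟨i, j, hij, rfl⟩, h⟩
  exact ⟨_, ⟨i, j, ne_of_adjacent hij, rfl⟩, h⟩

theorem InvLE.antisymm {u y : Perm (Fin n)} (h1 : InvLE u y) (h2 : InvLE y u) : u = y :=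
  h1.weakLE.bruhatLE.antisymm h2.weakLE.bruhatLE

end Weak

/-! ### Paths in the graph of `u` -/

section Graph

theorem exists_between_of_not_noBetween {x : Perm (Fin n)} {i j : Fin n} (h : ¬NoBetween x i j) :
    ∃ k, i < k ∧ k < j ∧ ((x i < x k ∧ x k < x j) ∨ (x j < x k ∧ x k < x i)) := by
  by_contra hc
  exact h fun k h1 h2 => ⟨fun h3 => hc ⟨k, h1, h2, .inl h3⟩, fun h3 => hc ⟨k, h1, h2, .inr h3⟩⟩

theorem transGen_lt {α β : Type*} [Preorder β] {r : α → α → Prop} {f : α → β}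
    (h : ∀ a b, r a b → f a < f b) {a b : α} (hab : TransGen r a b) : f a < f b := by
  induction hab with
  | single hab => exact h _ _ hab
  | tail _ hbc ih => exact ih.trans (h _ _ hbc)

theorem tildeEdge_apply_iff {w u : Perm (Fin n)} {i j : Fin n} :
    TildeEdge w u (u i) (u j) ↔ i < j ∧ BruhatLE (u * swap i j) w ∧ NoBetween u i j := by
  constructor
  · rintro ⟨k, l, hkl, hk, hl, h1, h2⟩
    obtain rfl := u.injective hk
    obtain rfl := u.injective hl
    exact ⟨hkl, h1, (abs_length_sub_eq_one_iff u hkl).1 h2⟩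
  · rintro ⟨h0, h1, h2⟩
    exact ⟨i, j, h0, rfl, rfl, h1, (abs_length_sub_eq_one_iff u h0).2 h2⟩

theorem TildeEdge.inv_lt {w u : Perm (Fin n)} {a b : Fin n} (h : TildeEdge w u a b) :
    u⁻¹ a < u⁻¹ b := by
  obtain ⟨i, j, hij, rfl, rfl, -⟩ := h
  simpa using hij

theorem TildeEdge.mono {w w' u : Perm (Fin n)} (hw : BruhatLE w w') {a b : Fin n}
    (h : TildeEdge w u a b) : TildeEdge w' u a b := by
  obtain ⟨i, j, hij, ha, hb, h1, h2⟩ := h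
  exact ⟨i, j, hij, ha, hb, h1.trans hw, h2⟩

/-- The inversions of `u` are directed paths in `Γ̃_w(u)`. -/
theorem transGen_tildeEdge_of_inversion {w u : Perm (Fin n)} (hu : BruhatLE u w) {i j : Fin n}
    (hij : i < j) (hx : u j < u i) : TransGen (TildeEdge w u) (u i) (u j) := by
  induction hd : j.val - i.val using Nat.strong_induction_on generalizing i j with
  | _ d ih =>
    by_cases hb : NoBetween u i j
    -- The swap goes down from `u`, so it stays in `[e, w]`.
    · refine .single (tildeEdge_apply_iff.2 ⟨hij, BruhatLE.trans ?_ hu, hb⟩)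
      have h1 := (length_mul_swap_lt_iff u hij).2 hx
      have h2 := (abs_length_sub_eq_one_iff u hij).2 hb
      rw [abs_eq (by norm_num)] at h2
      have h3 := bruhatLE_of_cover (u := u * swap i j) ⟨i, j, hij.ne, rfl⟩
        (by rw [mul_assoc, swap_mul_self, mul_one]; omega)
      rwa [mul_assoc, swap_mul_self, mul_one] at h3
    · obtain ⟨k, hik, hkj, hk⟩ := exists_between_of_not_noBetween hb
      rcases hk with hk | hk
      · exact absurd (hk.1.trans hk.2) hx.not_gt
      · simp only [Fin.lt_def] at hik hkj
        exact (ih _ (by omega) hik hk.2 rfl).trans (ih _ (by omega) hkj hk.1 rfl)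

theorem transGen_tildeEdge_of_inv_lt {w u : Perm (Fin n)} (hu : BruhatLE u w) {a b : Fin n}
    (hab : a < b) (hx : u⁻¹ b < u⁻¹ a) : TransGen (TildeEdge w u) b a := by
  simpa using transGen_tildeEdge_of_inversion hu hx (by simpa using hab)

theorem transGen_tildeEdge_inv_lt {w u : Perm (Fin n)} {a b : Fin n}
    (h : TransGen (TildeEdge w u) a b) : u⁻¹ a < u⁻¹ b :=
  transGen_lt (fun _ _ => TildeEdge.inv_lt) h

/-- Edges increase the position `u⁻¹`, so refining a path through intermediate vertices terminates.
-/
theorem hasPath_iff {w u : Perm (Fin n)} {a b : Fin n} :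
    HasPath w u a b ↔ TransGen (TildeEdge w u) a b := by
  refine ⟨TransGen.mono (fun _ _ h => h.1) a b, fun h => ?_⟩
  induction hd : (u⁻¹ b).val - (u⁻¹ a).val using Nat.strong_induction_on generalizing a b with
  | _ d ih =>
    have split : ∀ c, TransGen (TildeEdge w u) a c → TransGen (TildeEdge w u) c b →
        HasPath w u a b := fun c h1 h2 => by
      have l1 := transGen_tildeEdge_inv_lt h1
      have l2 := transGen_tildeEdge_inv_lt h2
      simp only [Fin.lt_def] at l1 l2
      exact (ih _ (by omega) h1 rfl).trans (ih _ (by omega) h2 rfl)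
    cases h with
    | single hab =>
      by_cases hc : ∃ c, TransGen (TildeEdge w u) a c ∧ TransGen (TildeEdge w u) c b
      · obtain ⟨c, h1, h2⟩ := hc
        exact split c h1 h2
      · exact .single ⟨hab, hc⟩
    | tail hac hcb => exact split _ hac (.single hcb)

/-- If `b` sits before `a` or after `c` in `u`, an inversion path extends the given path. Otherwise
induct on the path: its last edge cannot straddle `b` both in position and in value, by `NoBetween`.
-/
theorem transGen_tildeEdge_between {w u : Perm (Fin n)} (hu : BruhatLE u w) {a b c : Fin n}
    (hab : a < b) (hbc : b < c) (h : TransGen (TildeEdge w u) a c) :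
    TransGen (TildeEdge w u) a b ∨ TransGen (TildeEdge w u) b c := by
  rcases lt_or_gt_of_ne ((u⁻¹).injective.ne hab.ne) with h1 | h1
  · induction h with
    | @single c hac =>
      rcases lt_or_gt_of_ne ((u⁻¹).injective.ne hbc.ne) with h2 | h2
      · obtain ⟨i, rfl⟩ := u.surjective a
        obtain ⟨k, rfl⟩ := u.surjective b
        obtain ⟨j, rfl⟩ := u.surjective c
        have := (tildeEdge_apply_iff.1 hac).2.2 k (by simpa using h1) (by simpa using h2)
        exact absurd ⟨hab, hbc⟩ this.1
      · exact .inl (.head hac (transGen_tildeEdge_of_inv_lt hu hbc h2))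
    | @tail d c had hdc ih =>
      rcases lt_or_gt_of_ne ((u⁻¹).injective.ne hbc.ne) with h2 | h2
      · rcases lt_trichotomy b d with hbd | rfl | hbd
        · exact (ih hbd).imp_right fun h => h.tail hdc
        · exact .inl had
        · rcases lt_or_gt_of_ne ((u⁻¹).injective.ne hbd.ne) with h3 | h3
          · obtain ⟨i, rfl⟩ := u.surjective d
            obtain ⟨k, rfl⟩ := u.surjective b
            obtain ⟨j, rfl⟩ := u.surjective c
            have := (tildeEdge_apply_iff.1 hdc).2.2 k (by simpa using h3) (by simpa using h2)
            exact absurd ⟨hbd, hbc⟩ this.1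
          · exact .inr ((transGen_tildeEdge_of_inv_lt hu hbd h3).tail hdc)
      · exact .inl ((had.tail hdc).trans (transGen_tildeEdge_of_inv_lt hu hbc h2))
  · exact .inr ((transGen_tildeEdge_of_inv_lt hu hab h1).trans h)

end Graph

/-! ### Bruhat minimality as a linear extension condition -/

section LinearExtension

theorem IsRepr.lt_of_tildeEdge {w y u : Perm (Fin n)} (h : IsRepr w y u) {a b : Fin n}
    (hab : TildeEdge w u a b) : y⁻¹ a < y⁻¹ b := by
  obtain ⟨i, j, hij, rfl, rfl, h1, -⟩ := hab
  have h2 := h.2 _ h1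
  rw [← mul_assoc] at h2
  rcases h2.eq_or_length_lt with h3 | h3
  · exact absurd (swap_eq_one_iff.1 (left_eq_mul.1 h3)) hij.ne
  · simpa using (length_lt_mul_swap_iff _ hij).1 h3

/-- A local minimum is global, by induction from `w` to `ws`. If `u ⪯ w`, the graph for `w` is a
subgraph and lowering fixes `y⁻¹u`. Otherwise `us ⪯ w`, each edge of the graph of `us` for `w` is
respected because it is an edge or an inversion path of `u` for `ws`, and lowering turns `y⁻¹us`
into `y⁻¹u`. -/
theorem isRepr_of_tildeEdge_lt {w y u : Perm (Fin n)} (hu : BruhatLE u w)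
    (h : ∀ a b, TildeEdge w u a b → y⁻¹ a < y⁻¹ b) : IsRepr w y u := by
  induction w using bruhat_induction generalizing u with
  | one =>
    obtain rfl := bruhatLE_one_iff.1 hu
    refine ⟨hu, fun v hv => ?_⟩
    rw [bruhatLE_one_iff.1 hv]
    exact .refl _
  | step w i j hij hw ih =>
    have hws := bruhatLE_mul_swap_of_lt hij hw
    have hlt := lt_of_adjacent hij
    -- This edge is always present: `[e, ws]` is stable under right multiplication by `s`.
    have hp : (y⁻¹ * u) i < (y⁻¹ * u) j := by
      refine h _ _ (tildeEdge_apply_iff.2 ⟨hlt, ?_, fun k h1 h2 => ?_⟩)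
      · rw [bruhatLE_mul_swap_iff hij hw, mul_assoc, swap_mul_self, mul_one, or_comm]
        exact (bruhatLE_mul_swap_iff hij hw u).1 hu
      · simp only [Fin.lt_def] at h1 h2
        omega
    by_cases huw : BruhatLE u w
    · have h1 := (ih huw fun a b hab => h a b (hab.mono hws)).lower hij hw
      rwa [lower, if_neg hp.not_gt, mul_inv_cancel_left] at h1
    · have husw := ((bruhatLE_mul_swap_iff hij hw u).1 hu).resolve_left huw
      have hinv : u j < u i := by
        by_contra hc
        exact huw ((bruhatLE_mul_swap_of_lt hij (lt_of_le_of_ne (not_lt.1 hc)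
          (u.injective.ne hlt.ne))).trans husw)
      suffices hs : IsRepr w y (u * swap i j) by
        have h1 := hs.lower hij hw
        rw [lower, if_pos (by simpa using hp)] at h1
        simpa [mul_assoc] using h1
      refine ih husw fun a b hab => ?_
      obtain ⟨k, rfl⟩ := (u * swap i j).surjective a
      obtain ⟨l, rfl⟩ := (u * swap i j).surjective b
      obtain ⟨hkl, h1, h2⟩ := tildeEdge_apply_iff.1 hab
      have hne : ¬(k = i ∧ l = j) := by
        rintro ⟨rfl, rfl⟩
        rw [mul_assoc, swap_mul_self, mul_one] at h1
        exact huw h1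
      have hkl' := swap_adjacent_lt hij hkl hne
      rw [Perm.mul_apply, Perm.mul_apply]
      by_cases hb : NoBetween u (swap i j k) (swap i j l)
      · refine h _ _ (tildeEdge_apply_iff.2 ⟨hkl', ?_, hb⟩)
        rw [bruhatLE_mul_swap_iff hij hw]
        right
        rw [swap_apply_apply]
        simpa [mul_assoc] using h1
      · by_cases hx : u (swap i j l) < u (swap i j k)
        · exact transGen_lt h (transGen_tildeEdge_of_inversion hu hkl' hx)
        -- An intermediate entry for `u` would, moved by `s`, be one for `us`. The swap could spoil
        -- this only if `u i < u j`, against `hinv`.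
        · exfalso
          obtain ⟨m, hkm, hml, hm⟩ := exists_between_of_not_noBetween hb
          rcases hm with hm | hm
          · have h3 := swap_adjacent_lt hij hkm (by
              rintro ⟨h3, rfl⟩
              rw [h3] at hm
              exact lt_asymm hm.1 hinv)
            have h4 := swap_adjacent_lt hij hml (by
              rintro ⟨rfl, h3⟩
              rw [h3] at hm
              exact lt_asymm hm.2 hinv)
            rw [swap_apply_self] at h3 h4
            exact (h2 _ h3 h4).1 (by simpa using hm)
          · exact hx (hm.1.trans hm.2)

end LinearExtension

/-! ### The top of a class -/

section Top

/-- A transitive relation whose complement is transitive along increasing triples is the set of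
noninversions of a permutation. -/
theorem exists_perm_of_noninversions (P : Fin n → Fin n → Prop)
    (htrans : ∀ a b c, P a b → P b c → P a c)
    (hbetween : ∀ a b c, a < b → b < c → P a c → P a b ∨ P b c) :
    ∃ z : Perm (Fin n), ∀ a b, a < b → (z⁻¹ b < z⁻¹ a ↔ ¬P a b) := by
  classical
  -- The total order keeping the pairs in `P` and reversing the others; the inverse of `z` is its
  -- rank function.
  let r : Fin n → Fin n → Prop := fun a b => (a < b ∧ P a b) ∨ (b < a ∧ ¬P b a)
  have hr : ∀ a b c, r a b → r b c → r a c := by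
    intro a b c h1 h2
    have ht := htrans
    rcases h1 with ⟨l1, h1⟩ | ⟨l1, h1⟩ <;> rcases h2 with ⟨l2, h2⟩ | ⟨l2, h2⟩
    · exact .inl ⟨l1.trans l2, ht _ _ _ h1 h2⟩
    · rcases lt_trichotomy a c with l | rfl | l
      · exact .inl ⟨l, (hbetween _ _ _ l l2 h1).resolve_right h2⟩
      · exact absurd h1 h2
      · exact .inr ⟨l, fun h => h2 (ht _ _ _ h h1)⟩
    · rcases lt_trichotomy a c with l | rfl | l
      · exact .inl ⟨l, (hbetween _ _ _ l1 l h2).resolve_left h1⟩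
      · exact absurd h2 h1
      · exact .inr ⟨l, fun h => h1 (ht _ _ _ h2 h)⟩
    · exact .inr ⟨l2.trans l1, fun h => (hbetween _ _ _ l2 l1 h).elim h2 h1⟩
  have hirr : ∀ a, ¬r a a := fun a h => h.elim (fun h => lt_irrefl a h.1) fun h => lt_irrefl a h.1
  have htot : ∀ a b, a ≠ b → r a b ∨ r b a := by
    intro a b hab
    rcases lt_or_gt_of_ne hab with l | l
    · by_cases h : P a b
      exacts [.inl (.inl ⟨l, h⟩), .inr (.inr ⟨l, h⟩)]
    · by_cases h : P b a
      exacts [.inr (.inl ⟨l, h⟩), .inl (.inr ⟨l, h⟩)]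
  have hcard : ∀ a, (Finset.univ.filter fun b => r b a).card < n := fun a => by
    have := Finset.card_lt_card (Finset.filter_ssubset (p := fun b => r b a).2
      ⟨a, Finset.mem_univ a, hirr a⟩)
    rwa [Finset.card_univ, Fintype.card_fin] at this
  let f : Fin n → Fin n := fun a => ⟨_, hcard a⟩
  have hf : ∀ a b, r a b → f a < f b := fun a b hab => by
    change (Finset.univ.filter fun c => r c a).card < (Finset.univ.filter fun c => r c b).card
    refine Finset.card_lt_card (Finset.ssubset_iff_of_subset ?_ |>.2 ⟨a, ?_, ?_⟩)
    · intro c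
      simp only [Finset.mem_filter, Finset.mem_univ, true_and]
      exact fun hc => hr _ _ _ hc hab
    · simpa using hab
    · simpa using hirr a
  have hinj : Function.Injective f := fun a b hab => by
    by_contra hne
    rcases htot a b hne with h | h
    · exact (hf _ _ h).ne hab
    · exact (hf _ _ h).ne' hab
  refine ⟨(Equiv.ofBijective f (Finite.injective_iff_bijective.1 hinj))⁻¹, fun a b hab => ?_⟩
  rw [inv_inv]
  change f b < f a ↔ _
  by_cases h : P a b
  · simp [h, (hf a b (.inl ⟨hab, h⟩)).le]
  · simp [h, hf b a (.inr ⟨hab, h⟩)]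

theorem exists_isRepr_iff {w u : Perm (Fin n)} (hu : BruhatLE u w) :
    ∃ top : Perm (Fin n), (∀ a b, a < b → (top⁻¹ b < top⁻¹ a ↔ ¬HasPath w u a b)) ∧
      InvLE u top ∧ ∀ y, IsRepr w y u ↔ InvLE u y ∧ InvLE y top := by
  obtain ⟨top, htop⟩ := exists_perm_of_noninversions (TransGen (TildeEdge w u))
    (fun _ _ _ => TransGen.trans) (fun _ _ _ => transGen_tildeEdge_between hu)
  refine ⟨top, fun a b hab => by rw [hasPath_iff, htop a b hab], fun a b hab h => ?_, fun y => ?_⟩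
  · exact (htop a b hab).2 fun hP => h.not_gt (transGen_tildeEdge_inv_lt hP)
  · constructor
    · intro hy
      have hlt : ∀ a b, TransGen (TildeEdge w u) a b → y⁻¹ a < y⁻¹ b :=
        fun a b => transGen_lt fun _ _ h => hy.lt_of_tildeEdge h
      refine ⟨fun a b hab h => hlt _ _ (transGen_tildeEdge_of_inv_lt hu hab h), fun a b hab h => ?_⟩
      exact (htop a b hab).2 fun hP => h.not_gt (hlt _ _ hP)
    · rintro ⟨h1, h2⟩
      -- An edge with `a < b` is respected because `top` does not invert it; an edge with `b < a` is
      -- an inversion of `u`.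
      refine isRepr_of_tildeEdge_lt hu fun a b hab => ?_
      have hne : a ≠ b := fun h => by
        have := hab.inv_lt
        rw [h] at this
        exact lt_irrefl _ this
      rcases lt_or_gt_of_ne hne with l | l
      · by_contra hc
        exact (htop a b l).1 (h2 a b l (lt_of_le_of_ne (not_lt.1 hc) ((y⁻¹).injective.ne hne.symm)))
          (.single hab)
      · exact h1 b a l hab.inv_lt

end Top

/-! ### Linear functionals on `Q_w` -/

theorem dotProduct_vec_mul_swap (c : Fin n → ℝ) (u : Perm (Fin n)) (i j : Fin n) :
    c ⬝ᵥ vec u - c ⬝ᵥ vec (u * swap i j) = (c (u j) - c (u i)) * ((j : ℕ) - (i : ℕ) : ℝ) := by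
  have h : vec u - vec (u * swap i j) =
      Pi.single (u j) ((j : ℕ) - (i : ℕ) : ℝ) - Pi.single (u i) ((j : ℕ) - (i : ℕ) : ℝ) := by
    ext a
    obtain ⟨k, rfl⟩ := u.surjective a
    have hk : u⁻¹ (u k) = k := by simp
    simp only [vec, Pi.sub_apply, mul_inv_rev, swap_inv, Perm.mul_apply, hk,
      Pi.single_apply, u.injective.eq_iff, swap_apply_def]
    split_ifs with h1 h2 <;> simp_all
  rw [← dotProduct_sub, h, dotProduct_sub, dotProduct_single, dotProduct_single]
  ring

/-- Rearrangement: each Bruhat cover, translated by `y`, moves a value with larger `c`-coordinate to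
an earlier position. -/
theorem dotProduct_vec_le {c : Fin n → ℝ} {y p q : Perm (Fin n)} (hc : c ∈ braidCone y)
    (h : BruhatLE p q) : c ⬝ᵥ vec (y * q) ≤ c ⬝ᵥ vec (y * p) := by
  induction h with
  | refl => exact le_rfl
  | @tail a b _ hcov ih =>
    refine le_trans ?_ ih
    obtain ⟨t, ht, rfl, hl⟩ := hcov
    obtain ⟨k, l, hkl, rfl⟩ := ht.exists_lt
    have h1 := (length_lt_mul_swap_iff a hkl).1 (by omega)
    have h2 := dotProduct_vec_mul_swap c (y * a) k l
    have h3 : (0 : ℝ) ≤ (l : ℕ) - (k : ℕ) := by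
      rw [sub_nonneg, Nat.cast_le]
      exact hkl.le
    have h4 := mul_nonneg (sub_nonneg.2 (hc _ _ h1.le)) h3
    rw [← Perm.mul_apply, ← Perm.mul_apply, ← h2] at h4
    rw [← mul_assoc]
    linarith

/-- The open cone of the braid arrangement indexed by `y`. -/
def openBraidCone (y : Perm (Fin n)) : Set (Fin n → ℝ) :=
  {c | ∀ i j : Fin n, i < j → c (y i) < c (y j)}

theorem openBraidCone_subset (y : Perm (Fin n)) : openBraidCone y ⊆ braidCone y := by
  intro c hc i j hij
  rcases hij.eq_or_lt with rfl | h
  exacts [le_rfl, (hc i j h).le]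

theorem vec_mem_openBraidCone (y : Perm (Fin n)) : vec y ∈ openBraidCone y := by
  intro i j hij
  simpa [vec] using hij

theorem isOpen_openBraidCone (y : Perm (Fin n)) : IsOpen (openBraidCone y) := by
  simp only [openBraidCone, Set.ofPred_forall]
  refine isOpen_iInter_of_finite fun i => isOpen_iInter_of_finite fun j =>
    isOpen_iInter_of_finite fun _ => isOpen_lt (continuous_apply _) (continuous_apply _)

theorem dotProduct_vec_lt {c : Fin n → ℝ} {y p q : Perm (Fin n)} (hc : c ∈ openBraidCone y)
    (h : BruhatLE p q) (hne : p ≠ q) : c ⬝ᵥ vec (y * q) < c ⬝ᵥ vec (y * p) := by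
  rcases Relation.ReflTransGen.cases_tail h with h | ⟨a, hpa, t, ht, rfl, hl⟩
  · exact absurd h.symm hne
  refine lt_of_lt_of_le ?_ (dotProduct_vec_le (openBraidCone_subset y hc) hpa)
  obtain ⟨k, l, hkl, rfl⟩ := ht.exists_lt
  have h1 := (length_lt_mul_swap_iff a hkl).1 (by omega)
  have h2 := dotProduct_vec_mul_swap c (y * a) k l
  have h3 : (0 : ℝ) < (l : ℕ) - (k : ℕ) := by
    rw [sub_pos, Nat.cast_lt]
    exact hkl
  have h4 := mul_pos (sub_pos.2 (hc _ _ h1)) h3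
  rw [← Perm.mul_apply, ← Perm.mul_apply, ← h2] at h4
  rw [← mul_assoc]
  linarith

theorem vec_mem_polytope {w u : Perm (Fin n)} (h : BruhatLE u w) : vec u ∈ polytope w :=
  subset_convexHull ℝ _ ⟨u, h, rfl⟩

theorem dotProduct_le_of_mem_polytope {w : Perm (Fin n)} {c : Fin n → ℝ} {r : ℝ}
    (h : ∀ v, BruhatLE v w → c ⬝ᵥ vec v ≤ r) {q : Fin n → ℝ} (hq : q ∈ polytope w) :
    c ⬝ᵥ q ≤ r := by
  have hconv : Convex ℝ {q : Fin n → ℝ | c ⬝ᵥ q ≤ r} :=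
    convex_halfSpace_le ⟨dotProduct_add c, fun a q => dotProduct_smul a c q⟩ r
  refine convexHull_min ?_ hconv hq
  rintro _ ⟨v, hv, rfl⟩
  exact h v hv

theorem exists_vec_mem_face (w : Perm (Fin n)) (c : Fin n → ℝ) :
    ∃ u, BruhatLE u w ∧ vec u ∈ face (polytope w) c := by
  obtain ⟨u, hu, hmax⟩ := Set.exists_max_image {u | BruhatLE u w} (fun u => c ⬝ᵥ vec u)
    (Set.toFinite _) ⟨w, .refl w⟩
  exact ⟨u, hu, vec_mem_polytope hu, fun q hq => dotProduct_le_of_mem_polytope hmax hq⟩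

theorem IsRepr.mem_face {w y u : Perm (Fin n)} (h : IsRepr w y u) {c : Fin n → ℝ}
    (hc : c ∈ braidCone y) : vec u ∈ face (polytope w) c := by
  refine ⟨vec_mem_polytope h.1, fun q hq => dotProduct_le_of_mem_polytope (fun v hv => ?_) hq⟩
  simpa using dotProduct_vec_le hc (h.2 v hv)

theorem IsRepr.eq_of_mem_face {w y u v : Perm (Fin n)} (h : IsRepr w y u) {c : Fin n → ℝ}
    (hc : c ∈ openBraidCone y) (hv : BruhatLE v w) (hf : vec v ∈ face (polytope w) c) : v = u := by
  by_contra hne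
  have h1 := dotProduct_vec_lt hc (h.2 v hv) (fun he => hne (mul_left_cancel he).symm)
  have h2 := hf.2 _ (vec_mem_polytope h.1)
  simp only [mul_inv_cancel_left] at h1
  linarith

/-- A functional in the open cone of `y` is maximized over `Q_w` at `vec u` only. -/
theorem IsRepr.dotProduct_le_of_mem_face {w y u : Perm (Fin n)} (h : IsRepr w y u)
    {d : Fin n → ℝ} (hd : d ∈ openBraidCone y) (c : Fin n → ℝ) {p : Fin n → ℝ}
    (hp : p ∈ face (polytope w) d) : c ⬝ᵥ vec u ≤ c ⬝ᵥ p := by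
  -- With `K` above all these quotients, `K • d - c` is maximal at `vec u`; since `d` ties at `p`
  -- and `vec u`, the inequality for `c` remains.
  obtain ⟨K, hK⟩ := (Set.finite_range fun v : Perm (Fin n) =>
    (c ⬝ᵥ vec u - c ⬝ᵥ vec v) / (d ⬝ᵥ vec u - d ⬝ᵥ vec v)).bddAbove
  have h1 : (K • d - c) ⬝ᵥ p ≤ (K • d - c) ⬝ᵥ vec u := by
    refine dotProduct_le_of_mem_polytope (fun v hv => ?_) hp.1
    by_cases hne : u = v
    · rw [hne]
    · have h2 := dotProduct_vec_lt hd (h.2 v hv) (fun he => hne (mul_left_cancel he))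
      simp only [mul_inv_cancel_left] at h2
      have h3 := hK ⟨v, rfl⟩
      rw [div_le_iff₀ (sub_pos.2 h2)] at h3
      simp only [sub_dotProduct, smul_dotProduct, smul_eq_mul]
      linarith
  have h2 := hp.2 _ (vec_mem_polytope h.1)
  have h3 := (h.mem_face (openBraidCone_subset y hd)).2 p hp.1
  simp only [sub_dotProduct, smul_dotProduct, smul_eq_mul, le_antisymm h2 h3] at h1
  linarith

/-! ### The classes of `Θ_w` -/

/-- If `C(x)` lies in a normal cone, `vec x` is maximal at any vector `vec v` of its face with `v ⪯
w`, which forces `v` to be the representative of `x`. Conversely the normal cone of the face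
selected by `vec y` contains `C(x)` for every `x` with the same representative, and the open cone of
`y` makes it full-dimensional. -/
theorem theta_iff {w y z : Perm (Fin n)} :
    Theta w y z ↔ ∃ u, IsRepr w y u ∧ IsRepr w z u := by
  constructor
  · rintro ⟨_, ⟨c, rfl⟩, -, hy, hz⟩
    obtain ⟨v, hv, hvf⟩ := exists_vec_mem_face w c
    have key : ∀ x, braidCone x ⊆ normalCone (polytope w) (face (polytope w) c) →
        IsRepr w x v := fun x hx => by
      obtain ⟨u, hu⟩ := exists_isRepr w x
      have hm := vec_mem_openBraidCone x
      rwa [hu.eq_of_mem_face hm hv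
        ⟨vec_mem_polytope hv, hx (openBraidCone_subset x hm) _ hvf⟩]
    exact ⟨v, key y hy, key z hz⟩
  · rintro ⟨u, hy, hz⟩
    have key : ∀ x, IsRepr w x u →
        braidCone x ⊆ normalCone (polytope w) (face (polytope w) (vec y)) := by
      intro x hx c hc p hp q hq
      refine (hx.mem_face hc).2 q hq |>.trans ?_
      exact hy.dotProduct_le_of_mem_face (vec_mem_openBraidCone y) c hp
    refine ⟨_, ⟨vec y, rfl⟩, ⟨vec y, mem_interior.2 ⟨_, (openBraidCone_subset y).trans (key y hy),
      isOpen_openBraidCone y, vec_mem_openBraidCone y⟩⟩, key y hy, key z hz⟩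

theorem equivalence_theta (w : Perm (Fin n)) : Equivalence (Theta w) where
  refl y := by
    obtain ⟨u, hu⟩ := exists_isRepr w y
    exact theta_iff.2 ⟨u, hu, hu⟩
  symm h := by
    obtain ⟨u, h1, h2⟩ := theta_iff.1 h
    exact theta_iff.2 ⟨u, h2, h1⟩
  trans h h' := by
    obtain ⟨u, h1, h2⟩ := theta_iff.1 h
    obtain ⟨v, h3, h4⟩ := theta_iff.1 h'
    rw [h3.unique h2] at h4
    exact theta_iff.2 ⟨u, h1, h4⟩

theorem IsRepr.mem_thetaClass_iff {w x u : Perm (Fin n)} (h : IsRepr w x u) {y : Perm (Fin n)} :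
    y ∈ thetaClass w x ↔ IsRepr w y u := by
  refine theta_iff.trans ⟨?_, fun hy => ⟨u, h, hy⟩⟩
  rintro ⟨v, h1, h2⟩
  rwa [h.unique h1]

theorem leftInversions_eq_iff {z : Perm (Fin n)} {P : Fin n → Fin n → Prop} :
    leftInversions z = {t | ∃ a b : Fin n, a < b ∧ t = swap a b ∧ ¬P a b} ↔
      ∀ a b, a < b → (z⁻¹ b < z⁻¹ a ↔ ¬P a b) := by
  have hmem : ∀ a b, a < b →
      (swap a b ∈ {t | ∃ a b : Fin n, a < b ∧ t = swap a b ∧ ¬P a b} ↔ ¬P a b) := by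
    intro a b hab
    refine ⟨?_, fun h => ⟨a, b, hab, rfl, h⟩⟩
    rintro ⟨c, d, hcd, he, h⟩
    have h1 : swap c d a = b := by rw [← he, swap_apply_left]
    have h2 : swap c d b = a := by rw [← he, swap_apply_right]
    have : a = c ∧ b = d := by
      rw [swap_apply_def] at h1 h2
      split_ifs at h1 h2 <;> grind
    rwa [this.1, this.2]
  constructor
  · intro h a b hab
    rw [← mem_leftInversions_swap z hab, h, hmem a b hab]
  · intro h
    ext t
    constructor
    · intro ht
      obtain ⟨a, b, hab, rfl⟩ := ht.1.exists_lt
      exact (hmem a b hab).2 ((h a b hab).1 ((mem_leftInversions_swap z hab).1 ht))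
    · rintro ⟨a, b, hab, rfl, hP⟩
      exact (mem_leftInversions_swap z hab).2 ((h a b hab).2 hP)

end BruhatPolytope

open BruhatPolytope in
theorem proposition4p1 (n : ℕ) (w : Equiv.Perm (Fin n)) :
    Equivalence (BruhatPolytope.Theta w) ∧
    ∀ x : Equiv.Perm (Fin n), ∃ u top : Equiv.Perm (Fin n),
      -- `u` is the unique element of `[e, w]` in the class of `x`
      (∀ v, (v ∈ BruhatPolytope.thetaClass w x ∧ BruhatPolytope.BruhatLE v w) ↔ v = u) ∧
      -- `u` is the minimum and `top` the maximum of the class in right weak order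
      (u ∈ BruhatPolytope.thetaClass w x ∧
        ∀ y ∈ BruhatPolytope.thetaClass w x, BruhatPolytope.WeakLE u y) ∧
      (top ∈ BruhatPolytope.thetaClass w x ∧
        ∀ y ∈ BruhatPolytope.thetaClass w x, BruhatPolytope.WeakLE y top) ∧
      -- the class is the interval from `u` to `top`
      BruhatPolytope.thetaClass w x =
        {y | BruhatPolytope.WeakLE u y ∧ BruhatPolytope.WeakLE y top} ∧
      -- `top` is the one permutation with the given left inversions
      (∀ z, BruhatPolytope.leftInversions z =
          {t | ∃ a b : Fin n, a < b ∧ t = Equiv.swap a b ∧ ¬ BruhatPolytope.HasPath w u a b} ↔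
        z = top) := by
 
  refine ⟨equivalence_theta w, fun x => ?_⟩
  obtain ⟨u, hu⟩ := exists_isRepr w x
  obtain ⟨top, htop, hutop, hclass⟩ := exists_isRepr_iff hu.1
  have hmem : ∀ y, y ∈ thetaClass w x ↔ InvLE u y ∧ InvLE y top :=
    fun y => hu.mem_thetaClass_iff.trans (hclass y)
  simp only [weakLE_iff_invLE]
  refine ⟨u, top, fun v => ⟨?_, ?_⟩, ⟨?_, fun y hy => ((hmem y).1 hy).1⟩,
    ⟨(hmem top).2 ⟨hutop, fun _ _ _ h => h⟩, fun y hy => ((hmem y).1 hy).2⟩, Set.ext hmem,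
    fun z => ?_⟩
  · rintro ⟨h1, h2⟩
    exact (isRepr_self h2).unique (hu.mem_thetaClass_iff.1 h1)
  · rintro rfl
    exact ⟨hu.mem_thetaClass_iff.2 (isRepr_self hu.1), hu.1⟩
  · exact hu.mem_thetaClass_iff.2 (isRepr_self hu.1)
  · rw [leftInversions_eq_iff]
    refine ⟨fun h => InvLE.antisymm ?_ ?_, fun h => h ▸ htop⟩
    · exact fun a b hab h1 => (htop a b hab).2 ((h a b hab).1 h1)
    · exact fun a b hab h1 => (h a b hab).2 ((htop a b hab).1 h1)
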